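/- Let $(\Omega,\mathcal A,\mathbb P)$ be a probability space and $X$ a random element on it (for instance a random vector) such that there is a random variable on $\Omega$ that is uniform on $[0,1]$ and independent of $X$. For real random variables $Y,Z$ write $Y\le_1 Z$ (respectively $Y\le_2 Z$) if $\mathbb E[f(Y)]\le\mathbb E[f(Z)]$ for all increasing (respectively increasing concave) functions $f:\mathbb R\to\mathbb R$ for which both expectations exist (infinite values allowed; "increasing" is meant in the non-strict sense). Let $U$ be uniform on $[0,1]$; a random variable $P$ is a p-variable if $U\le_1 P$, and a p*-variable if $U\le_2 P$. A copy of a random variable $T$ is a random variable on $\Omega$ with the same distribution as $T$. Let $P:\Omega\to[0,\infty)$ be $\sigma(X)$-measurable. Then: (i) $P$ is a p-variable if and only if there exist a $\sigma(X)$-measurable random variable $T:\Omega\to\mathbb R$ and a copy $T'$ of $T$ independent of $X$ such that $P\ge\mathbb P(T'\le T\mid X)$ almost surely; (ii) $P$ is a p*-variable if and only if there exist a random variable $T:\Omega\to\mathbb R$ and a copy $T'$ of $T$ independent of $(T,X)$ such that $P\ge\mathbb P(T'\le T\mid X)$ almost surely. -/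

import Mathlib

open MeasureTheory ProbabilityTheory

/-- The uniform distribution on `[0, 1]`. -/
noncomputable def uniform01 : Measure ℝ := volume.restrict (Set.Icc (0 : ℝ) 1)

/-- The expectation of `X` under `μ` exists, possibly with an infinite value:
`E[X⁺]` or `E[X⁻]` is finite. -/
def ExpectationExists {Ω : Type*} [MeasurableSpace Ω] (μ : Measure Ω) (X : Ω → ℝ) : Prop :=
  AEMeasurable X μ ∧
    ((∫⁻ ω, ENNReal.ofReal (X ω) ∂μ) ≠ ⊤ ∨ (∫⁻ ω, ENNReal.ofReal (-X ω) ∂μ) ≠ ⊤)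

/-- The expectation `E[X⁺] - E[X⁻]`, with values in `[-∞, ∞]`; it is meaningful when
`ExpectationExists μ X` holds. -/
noncomputable def extExpectation {Ω : Type*} [MeasurableSpace Ω] (μ : Measure Ω)
    (X : Ω → ℝ) : EReal :=
  ((∫⁻ ω, ENNReal.ofReal (X ω) ∂μ : ENNReal) : EReal) -
    ((∫⁻ ω, ENNReal.ofReal (-X ω) ∂μ : ENNReal) : EReal)

/-- First-order stochastic dominance `X ≤₁ Y` (the variables may live on different spaces):
`E[f(X)] ≤ E[f(Y)]` for all increasing `f` for which the expectations exist. -/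
def StochLE1 {Ω Ω' : Type*} [MeasurableSpace Ω] [MeasurableSpace Ω']
    (μ : Measure Ω) (X : Ω → ℝ) (ν : Measure Ω') (Y : Ω' → ℝ) : Prop :=
  ∀ f : ℝ → ℝ, Monotone f →
    ExpectationExists μ (fun ω => f (X ω)) → ExpectationExists ν (fun ω => f (Y ω)) →
      extExpectation μ (fun ω => f (X ω)) ≤ extExpectation ν (fun ω => f (Y ω))

/-- Second-order stochastic dominance `X ≤₂ Y` (the variables may live on different spaces):
`E[f(X)] ≤ E[f(Y)]` for all increasing concave `f` for which the expectations exist. -/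
def StochLE2 {Ω Ω' : Type*} [MeasurableSpace Ω] [MeasurableSpace Ω']
    (μ : Measure Ω) (X : Ω → ℝ) (ν : Measure Ω') (Y : Ω' → ℝ) : Prop :=
  ∀ f : ℝ → ℝ, Monotone f → ConcaveOn ℝ Set.univ f →
    ExpectationExists μ (fun ω => f (X ω)) → ExpectationExists ν (fun ω => f (Y ω)) →
      extExpectation μ (fun ω => f (X ω)) ≤ extExpectation ν (fun ω => f (Y ω))

/-- `P` is a p-variable: `U ≤₁ P` for `U` uniform on `[0, 1]` (here the identity map under
the uniform distribution). -/
def IsPVariable {Ω : Type*} [MeasurableSpace Ω] (μ : Measure Ω) (P : Ω → ℝ) : Prop :=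
  StochLE1 uniform01 (fun u => u) μ P

/-- `P` is a p*-variable: `U ≤₂ P` for `U` uniform on `[0, 1]`. -/
def IsPStarVariable {Ω : Type*} [MeasurableSpace Ω] (μ : Measure Ω) (P : Ω → ℝ) : Prop :=
  StochLE2 uniform01 (fun u => u) μ P

/-- The conditional probability `ℙ(T' ≤ T | X)`, i.e. the conditional expectation of the
indicator of `{T' ≤ T}` given `σ(X)`. -/
noncomputable def condProbLE {Ω E : Type*} [MeasurableSpace Ω] [mE : MeasurableSpace E]
    (μ : Measure Ω) (T' T : Ω → ℝ) (X : Ω → E) : Ω → ℝ :=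
  condExp (MeasurableSpace.comap X mE) μ
    (Set.indicator {ω | T' ω ≤ T ω} (fun _ => (1 : ℝ)))

/-!
The two sufficiency claims rest on the inequality `u ≤ F (F⁻¹ u)`, by which `F(T)` dominates the
uniform distribution when `F` is the distribution function of `T`
(`extExpectation_uniform01_le_comp_cdf`). Independence gives `ℙ(T' ≤ T ∣ T, X) = F(T)`
(`condProbLE_eq_of_indepFun`). In the first claim this is already `ℙ(T' ≤ T ∣ X)`; in the second,
`ℙ(T' ≤ T ∣ X) = 𝔼[F(T) ∣ X]`, and conditional Jensen handles increasing concave test functions.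

A p-variable `P` is its own statistic `T`: its distribution function lies below the identity on
`[0, 1]`, so `F(P) ≤ P`.

For a p*-variable, the task is to find a uniform `V` with `𝔼[V ∣ X] ≤ P`, using randomness
independent of `X`; then `T = V` works, with `T'` a further independent uniform variable. This is a
case of Strassen's theorem, obtained here by an explicit coupling (`exists_swap_coupling`). Let `q` be
the quantile function of `min P 1`, so that dominance reads `∫₀ˣ u du ≤ ∫₀ˣ q(u) du` for all `x`. Hence
the deficit `(u - q(u))⁺ du` is stochastically larger than the excess `(q(u) - u)⁺ du`, and it is the
image of part of the excess under a coupling `π` that moves mass to the right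
(`exists_monotone_coupling`). Start from the diagonal coupling of the uniform distribution with
itself and, for each pair `(u, v)`, exchange the targets of a mass `π(du, dv) / (v - u)` at `u` and
at `v`. The marginals do not change, while the conditional mean increases by at most `q(u) - u` at
the excess points and decreases by `v - q(v)` at the deficit points, so that it ends below `q`. The
exchanged mass does not exceed the mass available because `u < q(u) ≤ q(v) < v`. Pushing the first
coordinate forward by `q`, disintegrating, and representing the resulting kernel by an independent
uniform variable gives `V` (`exists_uniform_randomization`).
-/

/-! ### Quantile functions of finite measures on the line -/

/-- The lower quantile function of a finite measure `m` on `ℝ`, on the open interval from `0` to the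
total mass of `m`; it is set to `0` elsewhere. -/
noncomputable def quantile (m : Measure ℝ) : ℝ → ℝ :=
  (Set.Ioo 0 (m.real Set.univ)).indicator fun t => sInf {x | t ≤ m.real (Set.Iic x)}

section Quantile

variable {m : Measure ℝ} [IsFiniteMeasure m] {t x : ℝ}

/-- The Galois connection between the quantile function and the distribution function. -/
lemma quantile_le_iff (ht : t ∈ Set.Ioo 0 (m.real Set.univ)) :
    quantile m t ≤ x ↔ t ≤ m.real (Set.Iic x) := by
  have hmono : Monotone fun y : ℝ => m.real (Set.Iic y) := fun y z hyz =>
    measureReal_mono (Set.Iic_subset_Iic.2 hyz)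
  rw [quantile, Set.indicator_of_mem ht]
  set S : Set ℝ := {y | t ≤ m.real (Set.Iic y)} with hS
  have htop : Filter.Tendsto (fun y : ℝ => m.real (Set.Iic y)) Filter.atTop
      (nhds (m.real Set.univ)) :=
    (ENNReal.tendsto_toReal (measure_ne_top m _)).comp (tendsto_measure_Iic_atTop m)
  have hbot : Filter.Tendsto (fun n : ℕ => m.real (Set.Iic (-(n : ℝ)))) Filter.atTop (nhds 0) := by
    have hInter : ⋂ n : ℕ, Set.Iic (-(n : ℝ)) = ∅ := by
      refine Set.eq_empty_of_forall_notMem fun y hy => ?_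
      obtain ⟨n, hn⟩ := exists_nat_gt (-y)
      have : y ≤ -(n : ℝ) := Set.mem_iInter.1 hy n
      linarith
    have h0 := tendsto_measure_iInter_atTop (μ := m) (s := fun n : ℕ => Set.Iic (-(n : ℝ)))
      (fun n => measurableSet_Iic.nullMeasurableSet)
      (fun a b hab => Set.Iic_subset_Iic.2 (by gcongr)) ⟨0, measure_ne_top m _⟩
    rw [hInter, measure_empty] at h0
    exact (ENNReal.tendsto_toReal ENNReal.zero_ne_top).comp h0
  have hne : S.Nonempty := by
    obtain ⟨y, hy⟩ := (htop.eventually (lt_mem_nhds ht.2)).exists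
    exact ⟨y, hy.le⟩
  have hbdd : BddBelow S := by
    obtain ⟨n, hy⟩ := (hbot.eventually (gt_mem_nhds ht.1)).exists
    refine ⟨-n, fun z hz => ?_⟩
    by_contra! hlt
    exact absurd (hz.trans (hmono hlt.le)) (not_le.2 hy)
  constructor
  · intro h
    -- right continuity of the distribution function, from continuity of `m` along `Iic (x + 1/n)`
    have hseq : Filter.Tendsto (fun n : ℕ => m.real (Set.Iic (x + 1 / ((n : ℝ) + 1))))
        Filter.atTop (nhds (m.real (Set.Iic x))) := by
      have hInter : ⋂ n : ℕ, Set.Iic (x + 1 / ((n : ℝ) + 1)) = Set.Iic x := by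
        ext y
        simp only [Set.mem_iInter, Set.mem_Iic]
        refine ⟨fun hy => ?_, fun hy n => hy.trans (by simp; positivity)⟩
        refine le_of_forall_pos_le_add fun ε hε => ?_
        obtain ⟨n, hn⟩ := exists_nat_one_div_lt hε
        exact (hy n).trans (by linarith)
      refine (ENNReal.tendsto_toReal (measure_ne_top m _)).comp ?_
      rw [← hInter]
      refine tendsto_measure_iInter_atTop (fun n => measurableSet_Iic.nullMeasurableSet) ?_
        ⟨0, measure_ne_top m _⟩
      intro a b hab
      refine Set.Iic_subset_Iic.2 ?_
      gcongr
    refine ge_of_tendsto' hseq fun n => ?_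
    have hlt : sInf S < x + 1 / ((n : ℝ) + 1) := h.trans_lt (by simp; positivity)
    obtain ⟨y, hyS, hy⟩ := exists_lt_of_csInf_lt hne hlt
    exact le_trans hyS (hmono hy.le)
  · intro h
    exact csInf_le hbdd h

lemma le_measureReal_Iic_quantile (ht : t ∈ Set.Ioo 0 (m.real Set.univ)) :
    t ≤ m.real (Set.Iic (quantile m t)) :=
  (quantile_le_iff ht).1 le_rfl

variable (m) in
lemma monotoneOn_quantile : MonotoneOn (quantile m) (Set.Ioo 0 (m.real Set.univ)) :=
  fun _ hs _ ht hst => (quantile_le_iff hs).2 (hst.trans (le_measureReal_Iic_quantile ht))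

variable (m) in
lemma measurable_quantile : Measurable (quantile m) := by
  refine measurable_of_Iic fun x => ?_
  have : quantile m ⁻¹' Set.Iic x =
      (Set.Ioo 0 (m.real Set.univ) ∩ Set.Iic (m.real (Set.Iic x))) ∪
        ((Set.Ioo 0 (m.real Set.univ))ᶜ ∩ {_t | 0 ≤ x}) := by
    ext t
    by_cases ht : t ∈ Set.Ioo 0 (m.real Set.univ)
    · simp only [Set.mem_preimage, Set.mem_Iic, quantile_le_iff ht, Set.mem_union, Set.mem_inter_iff,
        ht, true_and, Set.mem_compl_iff, not_true_eq_false, false_and, or_false]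
    · simp only [Set.mem_preimage, Set.mem_Iic, Set.mem_union, Set.mem_inter_iff, quantile,
        Set.indicator_of_notMem ht, ht, false_and, Set.mem_compl_iff, not_false_eq_true, true_and,
        false_or, Set.mem_ofPred_eq]
  rw [this]
  exact (measurableSet_Ioo.inter measurableSet_Iic).union
    (measurableSet_Ioo.compl.inter (MeasurableSet.const _))

variable (m) in
lemma map_quantile :
    (volume.restrict (Set.Ioo 0 (m.real Set.univ))).map (quantile m) = m := by
  refine Measure.ext_of_Iic _ _ fun x => ?_
  rw [Measure.map_apply (measurable_quantile m) measurableSet_Iic,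
    Measure.restrict_apply (measurable_quantile m measurableSet_Iic)]
  have hset : quantile m ⁻¹' Set.Iic x ∩ Set.Ioo 0 (m.real Set.univ) =
      Set.Iic (m.real (Set.Iic x)) ∩ Set.Ioo 0 (m.real Set.univ) := by
    ext t
    refine and_congr_left fun ht => ?_
    simp only [Set.mem_preimage, Set.mem_Iic, quantile_le_iff ht]
  have hle : m.real (Set.Iic x) ≤ m.real Set.univ := measureReal_mono (Set.subset_univ _)
  rw [hset]
  refine le_antisymm ?_ ?_
  · refine (measure_mono (t := Set.Ioc 0 (m.real (Set.Iic x)))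
      fun t ht => ⟨ht.2.1, ht.1⟩).trans ?_
    simp [Real.volume_Ioc, ofReal_measureReal]
  · refine le_trans ?_ (measure_mono (s := Set.Ioo 0 (m.real (Set.Iic x)))
      fun t ht => ⟨ht.2.le, ht.1, ht.2.trans_le hle⟩)
    simp [Real.volume_Ioo, ofReal_measureReal]

end Quantile

/-! ### The monotone coupling -/

/-- If `m₂` is stochastically larger than `m₁`, then some part of `m₁` can be transported onto `m₂`
by moving mass to the right only: couple the two quantile functions. -/
theorem exists_monotone_coupling (m₁ m₂ : Measure ℝ) [IsFiniteMeasure m₁] [IsFiniteMeasure m₂]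
    (h : ∀ x, m₂ (Set.Iic x) ≤ m₁ (Set.Iic x)) :
    ∃ π : Measure (ℝ × ℝ), π.map Prod.fst ≤ m₁ ∧ π.map Prod.snd = m₂ ∧
      ∀ᵐ z ∂π, z.1 ≤ z.2 := by
  have hreal : ∀ x, m₂.real (Set.Iic x) ≤ m₁.real (Set.Iic x) := fun x =>
    ENNReal.toReal_mono (measure_ne_top _ _) (h x)
  have hmass : m₂.real Set.univ ≤ m₁.real Set.univ := by
    refine ENNReal.toReal_mono (measure_ne_top _ _) ?_
    exact le_of_tendsto_of_tendsto' (tendsto_measure_Iic_atTop m₂) (tendsto_measure_Iic_atTop m₁) h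
  have hpair : Measurable fun t => (quantile m₁ t, quantile m₂ t) :=
    (measurable_quantile m₁).prodMk (measurable_quantile m₂)
  refine ⟨(volume.restrict (Set.Ioo 0 (m₂.real Set.univ))).map
    fun t => (quantile m₁ t, quantile m₂ t), ?_, ?_, ?_⟩
  · rw [Measure.map_map measurable_fst hpair]
    calc _ ≤ (volume.restrict (Set.Ioo 0 (m₁.real Set.univ))).map (quantile m₁) :=
          Measure.map_mono (Measure.restrict_mono_set _ (Set.Ioo_subset_Ioo_right hmass))
            (measurable_quantile m₁)
      _ = m₁ := map_quantile m₁
  · rw [Measure.map_map measurable_snd hpair]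
    exact map_quantile m₂
  · rw [ae_map_iff hpair.aemeasurable (measurableSet_le measurable_fst measurable_snd)]
    refine (ae_restrict_iff' measurableSet_Ioo).2 (Filter.Eventually.of_forall fun t ht => ?_)
    exact (quantile_le_iff ⟨ht.1, ht.2.trans_le hmass⟩).2
      ((le_measureReal_Iic_quantile ht).trans (hreal _))

/-! ### The swap coupling -/

/-- Reweighting `π` by at most the reciprocal of a density `d` that dominates the image of `π`
leaves an image measure dominated by the base measure on the support of `d`. -/
lemma map_withDensity_le_restrict {α β : Type*} [MeasurableSpace α] [MeasurableSpace β]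
    {π : Measure α} {lam : Measure β} {f : α → β} (hf : Measurable f) {d : β → ENNReal}
    (hd : Measurable d) (hle : π.map f ≤ lam.withDensity d) {w : α → ENNReal}
    (hw : ∀ᵐ z ∂π, w z ≤ (d (f z))⁻¹) :
    (π.withDensity w).map f ≤ lam.restrict {u | d u ≠ 0} := by
  have hA : MeasurableSet {u | d u ≠ 0} := (measurableSet_eq_fun hd measurable_const).compl
  refine Measure.le_iff.2 fun B hB => ?_
  rw [Measure.map_apply hf hB, withDensity_apply _ (hf hB)]
  calc ∫⁻ z in f ⁻¹' B, w z ∂π ≤ ∫⁻ z in f ⁻¹' B, (d (f z))⁻¹ ∂π :=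
        lintegral_mono_ae (ae_restrict_of_ae hw)
    _ = ∫⁻ u in B, (d u)⁻¹ ∂(π.map f) := (setLIntegral_map hB hd.inv hf).symm
    _ ≤ ∫⁻ u in B, (d u)⁻¹ ∂(lam.withDensity d) :=
        lintegral_mono' (Measure.restrict_mono subset_rfl hle) le_rfl
    _ = ∫⁻ u in B, (d * fun u => (d u)⁻¹) u ∂lam :=
        setLIntegral_withDensity_eq_setLIntegral_mul _ hd hd.inv hB
    _ ≤ ∫⁻ u in B, {u | d u ≠ 0}.indicator 1 u ∂lam := by
        refine lintegral_mono fun u => ?_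
        by_cases hu : d u = 0
        · simp [hu]
        · simp [Set.indicator, hu, ENNReal.mul_inv_le_one]
    _ = lam.restrict {u | d u ≠ 0} B := by
        rw [lintegral_indicator_one hA, Measure.restrict_apply hA, Measure.restrict_apply hB,
          Set.inter_comm]

/-- A one-dimensional Strassen theorem, by an explicit construction.  If the integrals of `q` over
all lower half-lines dominate those of the identity, then some self-coupling of `lam` has conditional
mean at most `q u` given the first coordinate `u`. -/
theorem exists_swap_coupling (lam : Measure ℝ) [IsFiniteMeasure lam] {s : Set ℝ}
    (hs : ∀ᵐ u ∂lam, u ∈ s) (hs0 : ∀ u ∈ s, 0 ≤ u) {q : ℝ → ℝ} (hq : Measurable q)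
    (hmono : MonotoneOn q s) (hq0 : ∀ u, 0 ≤ q u)
    (hqint : ∫⁻ u, ENNReal.ofReal (q u) ∂lam ≠ ⊤)
    (hidint : ∫⁻ u, ENNReal.ofReal u ∂lam ≠ ⊤)
    (hdom : ∀ x, ∫⁻ u in Set.Iic x, ENNReal.ofReal u ∂lam ≤
      ∫⁻ u in Set.Iic x, ENNReal.ofReal (q u) ∂lam) :
    ∃ Γ : Measure (ℝ × ℝ), Γ.map Prod.fst = lam ∧ Γ.map Prod.snd = lam ∧
      ∀ B, MeasurableSet B → ∫⁻ z in Prod.fst ⁻¹' B, ENNReal.ofReal z.2 ∂Γ ≤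
        ∫⁻ u in B, ENNReal.ofReal (q u) ∂lam := by
  -- the excess and the deficit of `q` with respect to the identity
  set d₁ : ℝ → ENNReal := fun u => ENNReal.ofReal (q u - u) with hd₁def
  set d₂ : ℝ → ENNReal := fun u => ENNReal.ofReal (u - q u) with hd₂def
  have hd₁ : Measurable d₁ := by fun_prop
  have hd₂ : Measurable d₂ := by fun_prop
  set m₁ := lam.withDensity d₁ with hm₁
  set m₂ := lam.withDensity d₂ with hm₂
  have hfin : ∀ d : ℝ → ENNReal, ∀ e : ℝ → ℝ, ∫⁻ u, ENNReal.ofReal (e u) ∂lam ≠ ⊤ →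
      (∀ u ∈ s, d u ≤ ENNReal.ofReal (e u)) → IsFiniteMeasure (lam.withDensity d) := by
    intro d e he hde
    refine isFiniteMeasure_withDensity (ne_top_of_le_ne_top he (lintegral_mono_ae ?_))
    filter_upwards [hs] with u hu using hde u hu
  have : IsFiniteMeasure m₁ := hfin _ q hqint fun u hu =>
    ENNReal.ofReal_le_ofReal (by linarith [hs0 u hu])
  have : IsFiniteMeasure m₂ := hfin _ (fun u => u) hidint fun u hu =>
    ENNReal.ofReal_le_ofReal (by linarith [hq0 u])
  -- `u + (q u - u)⁺ = q u + (u - q u)⁺`, integrated over `B`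
  have hbal : ∀ B, MeasurableSet B → ∫⁻ u in B, ENNReal.ofReal u ∂lam + m₁ B =
      ∫⁻ u in B, ENNReal.ofReal (q u) ∂lam + m₂ B := by
    intro B hB
    rw [hm₁, hm₂, withDensity_apply _ hB, withDensity_apply _ hB,
      ← lintegral_add_left (by fun_prop), ← lintegral_add_left (by fun_prop)]
    refine lintegral_congr_ae (ae_restrict_of_ae ?_)
    filter_upwards [hs] with u hu
    have h0 := hs0 u hu
    have h1 := hq0 u
    rcases le_total u (q u) with h | h
    · simp only [hd₁def, hd₂def]
      rw [← ENNReal.ofReal_add h0 (by linarith), ENNReal.ofReal_of_nonpos (p := u - q u)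
        (by linarith)]
      simp
    · simp only [hd₁def, hd₂def]
      rw [← ENNReal.ofReal_add h1 (by linarith), ENNReal.ofReal_of_nonpos (p := q u - u)
        (by linarith)]
      simp
  have hIic : ∀ x, m₂ (Set.Iic x) ≤ m₁ (Set.Iic x) := by
    intro x
    have hb := hbal _ (measurableSet_Iic (a := x))
    have hne : ∫⁻ u in Set.Iic x, ENNReal.ofReal u ∂lam ≠ ⊤ :=
      ne_top_of_le_ne_top hidint (setLIntegral_le_lintegral _ _)
    refine (ENNReal.add_le_add_iff_left hne).1 ?_
    rw [hb]
    exact add_le_add_left (hdom x) _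
  obtain ⟨π, hπ₁, hπ₂, hπle⟩ := exists_monotone_coupling m₁ m₂ hIic
  have hπae : ∀ᵐ z ∂π, z.1 < q z.1 ∧ q z.1 ≤ q z.2 ∧ q z.2 < z.2 := by
    have h1 : ∀ᵐ u ∂m₁, u ∈ s ∧ u < q u := by
      have : ∀ᵐ u ∂m₁, u ∈ s := (withDensity_absolutelyContinuous _ _).ae_le hs
      have h' : ∀ᵐ u ∂m₁, u < q u := by
        refine (ae_withDensity_iff hd₁).2 (Filter.Eventually.of_forall fun u hu => ?_)
        simpa [hd₁def] using hu
      filter_upwards [this, h'] with u a b using ⟨a, b⟩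
    have h2 : ∀ᵐ u ∂m₂, u ∈ s ∧ q u < u := by
      have : ∀ᵐ u ∂m₂, u ∈ s := (withDensity_absolutelyContinuous _ _).ae_le hs
      have h' : ∀ᵐ u ∂m₂, q u < u := by
        refine (ae_withDensity_iff hd₂).2 (Filter.Eventually.of_forall fun u hu => ?_)
        simpa [hd₂def] using hu
      filter_upwards [this, h'] with u a b using ⟨a, b⟩
    have h1' := ae_of_ae_map measurable_fst.aemeasurable
      ((Measure.absolutelyContinuous_of_le hπ₁).ae_le h1)
    have h2' := ae_of_ae_map measurable_snd.aemeasurable (hπ₂ ▸ h2 : ∀ᵐ u ∂(π.map Prod.snd), _)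
    filter_upwards [h1', h2', hπle] with z a b c
    exact ⟨a.2, hmono a.1 b.1 c, b.2⟩
  -- the mass to be swapped between `u` and `v` so as to carry a first moment `π (du, dv)`
  set w : ℝ × ℝ → ENNReal := fun z => (ENNReal.ofReal (z.2 - z.1))⁻¹ with hwdef
  have hw : Measurable w := by fun_prop
  set σ := π.withDensity w with hσ
  have hσ₁ : σ.map Prod.fst ≤ lam.restrict {u | d₁ u ≠ 0} := by
    refine map_withDensity_le_restrict measurable_fst hd₁ hπ₁ ?_
    filter_upwards [hπae] with z hz
    exact ENNReal.inv_le_inv.2 (ENNReal.ofReal_le_ofReal (by linarith [hz.2.1, hz.2.2]))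
  have hσ₂ : σ.map Prod.snd ≤ lam.restrict {u | d₂ u ≠ 0} := by
    refine map_withDensity_le_restrict measurable_snd hd₂ hπ₂.le ?_
    filter_upwards [hπae] with z hz
    exact ENNReal.inv_le_inv.2 (ENNReal.ofReal_le_ofReal (by linarith [hz.2.1, hz.1]))
  have hσle : σ.map Prod.fst + σ.map Prod.snd ≤ lam := by
    refine (add_le_add hσ₁ hσ₂).trans ?_
    rw [← Measure.restrict_union]
    · exact Measure.restrict_le_self
    · refine Set.disjoint_left.2 fun u hu hu' => ?_
      simp only [hd₁def, hd₂def, ne_eq, Set.mem_ofPred_eq, ENNReal.ofReal_eq_zero, not_le] at hu hu'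
      linarith
    · exact (measurableSet_eq_fun hd₂ measurable_const).compl
  have : IsFiniteMeasure (σ.map Prod.fst + σ.map Prod.snd) := isFiniteMeasure_of_le lam hσle
  have hρ := Measure.sub_add_cancel_of_le hσle
  set ρ := lam - (σ.map Prod.fst + σ.map Prod.snd) with hρdef
  have hdiag : Measurable fun u : ℝ => (u, u) := by fun_prop
  refine ⟨ρ.map (fun u => (u, u)) + (σ + σ.map Prod.swap), ?_, ?_, ?_⟩
  · rw [Measure.map_add _ _ measurable_fst, Measure.map_add _ _ measurable_fst,
      Measure.map_map measurable_fst hdiag, Measure.map_map measurable_fst measurable_swap]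
    conv_rhs => rw [← hρ]
    congr 1
    exact Measure.map_id
  · rw [Measure.map_add _ _ measurable_snd, Measure.map_add _ _ measurable_snd,
      Measure.map_map measurable_snd hdiag, Measure.map_map measurable_snd measurable_swap]
    conv_rhs => rw [← hρ, add_comm (σ.map Prod.fst)]
    congr 1
    exact Measure.map_id
  · intro B hB
    -- by the choice of `w`, the first moments of `σ` in the two coordinates differ by `π`
    have hshift : ∀ S, MeasurableSet S → ∫⁻ z in S, ENNReal.ofReal z.2 ∂σ =
        ∫⁻ z in S, ENNReal.ofReal z.1 ∂σ + π S := by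
      intro S hS
      rw [hσ, setLIntegral_withDensity_eq_setLIntegral_mul _ hw (by fun_prop) hS,
        setLIntegral_withDensity_eq_setLIntegral_mul _ hw (by fun_prop) hS, ← setLIntegral_one,
        ← lintegral_add_left (by fun_prop)]
      refine lintegral_congr_ae (ae_restrict_of_ae ?_)
      have hpos : ∀ᵐ z ∂π, 0 ≤ z.1 := by
        have : ∀ᵐ u ∂m₁, 0 ≤ u :=
          (withDensity_absolutelyContinuous _ _).ae_le (hs.mono hs0)
        exact ae_of_ae_map measurable_fst.aemeasurable
          ((Measure.absolutelyContinuous_of_le hπ₁).ae_le this)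
      filter_upwards [hπae, hpos] with z hz hz0
      have hlt : 0 < z.2 - z.1 := by linarith [hz.1, hz.2.1, hz.2.2]
      have hsplit : ENNReal.ofReal z.2 = ENNReal.ofReal z.1 + ENNReal.ofReal (z.2 - z.1) := by
        rw [← ENNReal.ofReal_add hz0 hlt.le]; congr 1; ring
      simp only [Pi.mul_apply, hwdef]
      rw [hsplit, mul_add, ENNReal.inv_mul_cancel (ENNReal.ofReal_pos.2 hlt).ne'
        ENNReal.ofReal_ne_top]
    have hΓ : ∫⁻ z in Prod.fst ⁻¹' B, ENNReal.ofReal z.2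
          ∂(ρ.map (fun u => (u, u)) + (σ + σ.map Prod.swap)) =
        ∫⁻ u in B, ENNReal.ofReal u ∂ρ + (∫⁻ z in Prod.fst ⁻¹' B, ENNReal.ofReal z.2 ∂σ +
          ∫⁻ z in Prod.snd ⁻¹' B, ENNReal.ofReal z.1 ∂σ) := by
      rw [Measure.restrict_add, Measure.restrict_add, lintegral_add_measure, lintegral_add_measure,
        setLIntegral_map (measurable_fst hB) (by fun_prop) hdiag,
        setLIntegral_map (measurable_fst hB) (by fun_prop) measurable_swap]
      rfl
    have hlam : ∫⁻ u in B, ENNReal.ofReal u ∂lam =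
        ∫⁻ u in B, ENNReal.ofReal u ∂ρ + (∫⁻ z in Prod.fst ⁻¹' B, ENNReal.ofReal z.1 ∂σ +
          ∫⁻ z in Prod.snd ⁻¹' B, ENNReal.ofReal z.2 ∂σ) := by
      conv_lhs => rw [← hρ]
      rw [Measure.restrict_add, Measure.restrict_add, lintegral_add_measure, lintegral_add_measure,
        setLIntegral_map hB (by fun_prop) measurable_fst,
        setLIntegral_map hB (by fun_prop) measurable_snd]
    have hπ₁B : π (Prod.fst ⁻¹' B) ≤ m₁ B := by
      rw [← Measure.map_apply measurable_fst hB]; exact hπ₁ B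
    have hπ₂B : π (Prod.snd ⁻¹' B) = m₂ B := by
      rw [← Measure.map_apply measurable_snd hB, hπ₂]
    have h2 := hshift _ (measurable_snd hB)
    refine (ENNReal.add_le_add_iff_right (measure_ne_top m₂ B)).1 ?_
    rw [← hbal B hB, hlam, hΓ, hshift _ (measurable_fst hB), h2, hπ₂B]
    calc _ = (∫⁻ u in B, ENNReal.ofReal u ∂ρ + (∫⁻ z in Prod.fst ⁻¹' B, ENNReal.ofReal z.1 ∂σ +
          (∫⁻ z in Prod.snd ⁻¹' B, ENNReal.ofReal z.1 ∂σ + m₂ B))) + π (Prod.fst ⁻¹' B) := by ring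
      _ ≤ _ := by gcongr

/-! ### Strassen's theorem for the uniform distribution -/

instance isProbabilityMeasure_uniform01 : IsProbabilityMeasure uniform01 :=
  ⟨by simp [uniform01]⟩

lemma uniform01_eq_restrict_Ioo : uniform01 = volume.restrict (Set.Ioo 0 1) :=
  Measure.restrict_congr_set Ioo_ae_eq_Icc.symm

lemma ae_uniform01_mem_Ioo : ∀ᵐ u ∂uniform01, u ∈ Set.Ioo (0 : ℝ) 1 := by
  rw [uniform01_eq_restrict_Ioo]
  exact ae_restrict_mem measurableSet_Ioo

lemma map_quantile_uniform01 (m : Measure ℝ) [IsProbabilityMeasure m] :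
    uniform01.map (quantile m) = m := by
  have h := map_quantile m
  rwa [probReal_univ, ← uniform01_eq_restrict_Ioo] at h

lemma map_coe_unitInterval : (volume : Measure unitInterval).map ((↑) : unitInterval → ℝ) =
    uniform01 :=
  unitInterval.measurePreserving_coe.map_eq

lemma map_projIcc_uniform01 :
    uniform01.map (Set.projIcc (0 : ℝ) 1 zero_le_one) = (volume : Measure unitInterval) := by
  rw [← map_coe_unitInterval,
    Measure.map_map continuous_projIcc.measurable measurable_subtype_coe]
  have : Set.projIcc (0 : ℝ) 1 zero_le_one ∘ ((↑) : unitInterval → ℝ) = id := by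
    ext x; simp
  rw [this, Measure.map_id]

lemma quantile_nonneg {m : Measure ℝ} [IsFiniteMeasure m] (hm : ∀ᵐ p ∂m, 0 ≤ p) (t : ℝ) :
    0 ≤ quantile m t := by
  by_cases ht : t ∈ Set.Ioo 0 (m.real Set.univ)
  · by_contra! hlt
    have h0 : m.real (Set.Iic (quantile m t)) = 0 := by
      rw [measureReal_eq_zero_iff]
      refine measure_mono_null (fun p hp => ?_) (ae_iff.1 hm)
      exact not_le.2 (lt_of_le_of_lt hp hlt)
    exact absurd (le_measureReal_Iic_quantile ht) (by rw [h0]; exact not_le.2 ht.1)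
  · rw [quantile, Set.indicator_of_notMem ht]

/-- A law on `[0, 1]` that dominates the uniform distribution for the test functions `min · x`
dominates it in the integrated quantile functions. -/
lemma setLIntegral_Iic_le_setLIntegral_quantile (ν : Measure ℝ) [IsProbabilityMeasure ν]
    (hν : ∀ᵐ p ∂ν, p ∈ Set.Icc (0 : ℝ) 1)
    (hmin : ∀ x, ∫ u, min u x ∂uniform01 ≤ ∫ p, min p x ∂ν) (x : ℝ) :
    ∫⁻ u in Set.Iic x, ENNReal.ofReal u ∂uniform01 ≤
      ∫⁻ u in Set.Iic x, ENNReal.ofReal (quantile ν u) ∂uniform01 := by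
  set q := quantile ν with hqdef
  have hq : Measurable q := measurable_quantile ν
  have hmap : uniform01.map q = ν := map_quantile_uniform01 ν
  have hq1 : ∀ᵐ u ∂uniform01, q u ∈ Set.Icc (0 : ℝ) 1 := by
    rw [← hmap] at hν
    exact ae_of_ae_map hq.aemeasurable hν
  have hid1 : ∀ᵐ u ∂uniform01, u ∈ Set.Icc (0 : ℝ) 1 :=
    ae_uniform01_mem_Ioo.mono fun u hu => Set.Ioo_subset_Icc_self hu
  have hint : ∀ f : ℝ → ℝ, Measurable f → (∀ᵐ u ∂uniform01, f u ∈ Set.Icc (0 : ℝ) 1) →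
      Integrable f uniform01 := fun f hf h =>
    Integrable.of_bound hf.aestronglyMeasurable 1 (h.mono fun u hu => by
      rw [Real.norm_eq_abs, abs_of_nonneg hu.1]; exact hu.2)
  have hqi := hint q hq hq1
  have hidi := hint (fun u => u) measurable_id hid1
  have hci : Integrable ((Set.Ioi x).indicator fun _ => x) uniform01 :=
    (integrable_const x).indicator measurableSet_Ioi
  have hreal : ∫ u in Set.Iic x, u ∂uniform01 ≤ ∫ u in Set.Iic x, q u ∂uniform01 := by
    rw [← integral_indicator measurableSet_Iic, ← integral_indicator measurableSet_Iic]
    calc ∫ u, (Set.Iic x).indicator (fun u => u) u ∂uniform01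
        = ∫ u, (min u x - (Set.Ioi x).indicator (fun _ => x) u) ∂uniform01 := by
          refine integral_congr_ae (Filter.Eventually.of_forall fun u => ?_)
          rcases le_or_gt u x with h | h
          · simp [h, not_lt.2 h]
          · simp [h, not_le.2 h, h.le]
      _ ≤ ∫ u, (min (q u) x - (Set.Ioi x).indicator (fun _ => x) u) ∂uniform01 := by
          have hidx : Integrable (fun u => min u x) uniform01 := hidi.inf (integrable_const x)
          have hqx : Integrable (fun u => min (q u) x) uniform01 := hqi.inf (integrable_const x)
          rw [integral_sub hidx hci, integral_sub hqx hci]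
          refine sub_le_sub_right ((hmin x).trans_eq ?_) _
          conv_lhs => rw [← hmap]
          exact integral_map hq.aemeasurable (by fun_prop)
      _ ≤ ∫ u, (Set.Iic x).indicator q u ∂uniform01 := by
          refine integral_mono ((hqi.inf (integrable_const x)).sub hci)
            (hqi.indicator measurableSet_Iic) fun u => ?_
          rcases le_or_gt u x with h | h
          · simp [h, not_lt.2 h]
          · simp [h, not_le.2 h]
  rw [← ofReal_integral_eq_lintegral_ofReal hidi.integrableOn
      (ae_restrict_of_ae (hid1.mono fun u hu => hu.1)),
    ← ofReal_integral_eq_lintegral_ofReal hqi.integrableOn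
      (ae_restrict_of_ae (hq1.mono fun u hu => hu.1))]
  exact ENNReal.ofReal_le_ofReal hreal

/-- Strassen's theorem with randomization: if a law `ν` on `[0, 1]` dominates the uniform
distribution for the increasing concave test functions `min · x`, then a uniform variable can be sampled from a
`ν`-distributed one and independent randomness, with conditional mean at most the latter. -/
theorem exists_uniform_randomization (ν : Measure ℝ) [IsProbabilityMeasure ν]
    (hν : ∀ᵐ p ∂ν, p ∈ Set.Icc (0 : ℝ) 1)
    (hmin : ∀ x, ∫ u, min u x ∂uniform01 ≤ ∫ p, min p x ∂ν) :
    ∃ h : ℝ → unitInterval → ℝ, Measurable (Function.uncurry h) ∧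
      (ν.prod volume).map (Function.uncurry h) = uniform01 ∧
      ∀ᵐ p ∂ν, ∫⁻ t, ENNReal.ofReal (h p t) ≤ ENNReal.ofReal p := by
  set q := quantile ν with hqdef
  have hq : Measurable q := measurable_quantile ν
  have hmap : uniform01.map q = ν := map_quantile_uniform01 ν
  have hν1 : ∫⁻ p, ENNReal.ofReal p ∂ν ≤ 1 := by
    calc ∫⁻ p, ENNReal.ofReal p ∂ν ≤ ∫⁻ _, 1 ∂ν :=
          lintegral_mono_ae (hν.mono fun p hp => ENNReal.ofReal_le_one.2 hp.2)
      _ = 1 := by simp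
  have hid1 : ∫⁻ u, ENNReal.ofReal u ∂uniform01 ≤ 1 := by
    calc ∫⁻ u, ENNReal.ofReal u ∂uniform01 ≤ ∫⁻ _, 1 ∂uniform01 :=
          lintegral_mono_ae (ae_uniform01_mem_Ioo.mono fun p hp => ENNReal.ofReal_le_one.2 hp.2.le)
      _ = 1 := by simp
  have hq1 : ∫⁻ u, ENNReal.ofReal (q u) ∂uniform01 ≤ 1 := by
    rwa [← hmap, lintegral_map (by fun_prop) hq] at hν1
  have hmono : MonotoneOn q (Set.Ioo 0 1) := by
    simpa only [probReal_univ] using monotoneOn_quantile ν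
  obtain ⟨Γ, hΓ₁, hΓ₂, hΓ⟩ := exists_swap_coupling uniform01 ae_uniform01_mem_Ioo
    (fun u hu => hu.1.le) hq hmono (quantile_nonneg (hν.mono fun p hp => hp.1))
    (ne_top_of_le_ne_top ENNReal.one_ne_top hq1) (ne_top_of_le_ne_top ENNReal.one_ne_top hid1)
    (setLIntegral_Iic_le_setLIntegral_quantile ν hν hmin)
  have hqid : Measurable (Prod.map q (id : ℝ → ℝ)) := hq.prodMap measurable_id
  have hΓprob : IsProbabilityMeasure Γ := by
    refine ⟨?_⟩
    rw [← Set.preimage_univ (f := Prod.fst), ← Measure.map_apply measurable_fst MeasurableSet.univ,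
      hΓ₁, measure_univ]
  set ρ := Γ.map (Prod.map q (id : ℝ → ℝ)) with hρ
  have hρprob : IsProbabilityMeasure ρ := Measure.isProbabilityMeasure_map hqid.aemeasurable
  have hfst : ρ.fst = ν := by
    rw [Measure.fst, hρ, Measure.map_map measurable_fst hqid]
    change Γ.map (q ∘ Prod.fst) = ν
    rw [← Measure.map_map hq measurable_fst, hΓ₁, hmap]
  have hsnd : ρ.map Prod.snd = uniform01 := by
    rw [hρ, Measure.map_map measurable_snd hqid]
    exact hΓ₂
  obtain ⟨h, hh, hκ⟩ := Kernel.exists_measurable_map_eq_unitInterval ρ.condKernel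
  refine ⟨h, hh, ?_, ?_⟩
  · refine Measure.ext fun S hS => ?_
    rw [Measure.map_apply hh hS, Measure.prod_apply (hh hS), ← hsnd,
      Measure.map_apply measurable_snd hS]
    conv_rhs => rw [← ρ.disintegrate ρ.condKernel]
    rw [Measure.compProd_apply (measurable_snd hS), hfst]
    refine lintegral_congr fun p => ?_
    rw [← hκ p]
    exact (Measure.map_apply hh.of_uncurry_left hS).symm
  · have hmeas : Measurable fun p => ∫⁻ t, ENNReal.ofReal (h p t) :=
      Measurable.lintegral_prod_right' (f := fun z => ENNReal.ofReal (Function.uncurry h z))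
        hh.ennreal_ofReal
    refine ae_le_of_forall_setLIntegral_le_of_sigmaFinite hmeas fun B hB _ => ?_
    have hinner : ∀ p, ∫⁻ t, ENNReal.ofReal (h p t) = ∫⁻ v, ENNReal.ofReal v ∂ρ.condKernel p := by
      intro p
      rw [← hκ p, lintegral_map (by fun_prop) hh.of_uncurry_left]
    simp_rw [hinner]
    calc ∫⁻ p in B, ∫⁻ v, ENNReal.ofReal v ∂ρ.condKernel p ∂ν
        = ∫⁻ z in B ×ˢ Set.univ, ENNReal.ofReal z.2 ∂ρ := by
          rw [← hfst]
          exact Measure.setLIntegral_condKernel_univ_right (ρ := ρ)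
            (f := fun z => ENNReal.ofReal z.2) (by fun_prop) hB
      _ = ∫⁻ z in Prod.fst ⁻¹' (q ⁻¹' B), ENNReal.ofReal z.2 ∂Γ := by
          rw [hρ, setLIntegral_map (hB.prod MeasurableSet.univ) (by fun_prop) hqid]
          congr 2
          ext z; simp
      _ ≤ ∫⁻ u in q ⁻¹' B, ENNReal.ofReal (q u) ∂uniform01 := hΓ _ (hq hB)
      _ = ∫⁻ p in B, ENNReal.ofReal p ∂ν := by
          conv_rhs => rw [← hmap]
          rw [setLIntegral_map hB (by fun_prop) hq]

/-! ### Extended expectations and dominance -/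

section Expectation

variable {Ω : Type*} [MeasurableSpace Ω] {μ : Measure Ω}

lemma extExpectation_mono {X Y : Ω → ℝ} (h : X ≤ᵐ[μ] Y) :
    extExpectation μ X ≤ extExpectation μ Y := by
  refine EReal.sub_le_sub ?_ ?_
  · exact EReal.coe_ennreal_le_coe_ennreal_iff.2
      (lintegral_mono_ae (h.mono fun ω hω => ENNReal.ofReal_le_ofReal hω))
  · exact EReal.coe_ennreal_le_coe_ennreal_iff.2
      (lintegral_mono_ae (h.mono fun ω hω => ENNReal.ofReal_le_ofReal (neg_le_neg hω)))

lemma extExpectation_map {Ω' : Type*} [MeasurableSpace Ω'] {g : Ω → Ω'} (hg : Measurable g)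
    {f : Ω' → ℝ} (hf : Measurable f) :
    extExpectation (μ.map g) f = extExpectation μ (fun ω => f (g ω)) := by
  rw [extExpectation, extExpectation, lintegral_map (by fun_prop) hg,
    lintegral_map (by fun_prop) hg]

lemma extExpectation_eq_integral {X : Ω → ℝ} (hX : Integrable X μ) :
    extExpectation μ X = ((∫ ω, X ω ∂μ : ℝ) : EReal) := by
  have h1 : ∫⁻ ω, ENNReal.ofReal (X ω) ∂μ ≠ ⊤ := hX.lintegral_lt_top.ne
  have h2 : ∫⁻ ω, ENNReal.ofReal (-X ω) ∂μ ≠ ⊤ := hX.neg.lintegral_lt_top.ne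
  rw [extExpectation, integral_eq_lintegral_pos_part_sub_lintegral_neg_part hX, EReal.coe_sub,
    EReal.coe_ennreal_toReal h1, EReal.coe_ennreal_toReal h2]

lemma MeasureTheory.Integrable.expectationExists {X : Ω → ℝ} (hX : Integrable X μ) :
    ExpectationExists μ X :=
  ⟨hX.1.aemeasurable, Or.inl hX.lintegral_lt_top.ne⟩

lemma integral_indicator_Ioi_comp (μ : Measure Ω) [IsFiniteMeasure μ] {Y : Ω → ℝ}
    (hY : Measurable Y) (a : ℝ) :
    Integrable (fun ω => (Set.Ioi a).indicator (1 : ℝ → ℝ) (Y ω)) μ ∧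
      ∫ ω, (Set.Ioi a).indicator (1 : ℝ → ℝ) (Y ω) ∂μ = μ.real (Y ⁻¹' Set.Ioi a) :=
  ⟨(integrable_const (1 : ℝ)).indicator (hY measurableSet_Ioi),
    integral_indicator_one (hY measurableSet_Ioi)⟩

variable [IsProbabilityMeasure μ]

/-- A p-variable is super-uniform: test dominance on the indicator of `(a, ∞)`. -/
lemma IsPVariable.measureReal_le {P : Ω → ℝ} (hP : Measurable P) (h : IsPVariable μ P) {a : ℝ}
    (ha0 : 0 ≤ a) (ha1 : a ≤ 1) : μ.real {ω | P ω ≤ a} ≤ a := by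
  set f : ℝ → ℝ := (Set.Ioi a).indicator 1 with hf
  have hmono : Monotone f := by
    intro x y hxy
    by_cases hx : a < x
    · simp [hf, hx, hx.trans_le hxy]
    · rw [hf, Set.indicator_of_notMem (show x ∉ Set.Ioi a from hx)]
      exact Set.indicator_nonneg (fun _ _ => zero_le_one) y
  obtain ⟨hi₁, he₁⟩ := integral_indicator_Ioi_comp uniform01 (Y := fun u => u) measurable_id a
  obtain ⟨hi₂, he₂⟩ := integral_indicator_Ioi_comp μ hP a
  have hle := h f hmono hi₁.expectationExists hi₂.expectationExists
  rw [extExpectation_eq_integral hi₁, extExpectation_eq_integral hi₂, EReal.coe_le_coe_iff, he₁,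
    he₂] at hle
  have hu : uniform01.real ((fun u : ℝ => u) ⁻¹' Set.Ioi a) = 1 - a := by
    have hset : Set.Ioi a ∩ Set.Icc 0 1 = Set.Ioc a 1 := by
      ext x; constructor
      · exact fun hx => ⟨hx.1, hx.2.2⟩
      · exact fun hx => ⟨hx.1, ha0.trans hx.1.le, hx.2⟩
    rw [Set.preimage_id', measureReal_def, uniform01, Measure.restrict_apply measurableSet_Ioi,
      hset, Real.volume_Ioc, ENNReal.toReal_ofReal (by linarith)]
  have hc : {ω | P ω ≤ a} = (P ⁻¹' Set.Ioi a)ᶜ := by ext ω; simp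
  rw [hc, probReal_compl_eq_one_sub (hP measurableSet_Ioi)]
  linarith

/-- For nonnegative variables the test functions `min · x` have finite expectations. -/
lemma IsPStarVariable.integral_min_le {P : Ω → ℝ} (hP : Measurable P) (hP0 : ∀ ω, 0 ≤ P ω)
    (h : IsPStarVariable μ P) (x : ℝ) :
    ∫ u, min u x ∂uniform01 ≤ ∫ ω, min (P ω) x ∂μ := by
  have hbound : ∀ y : ℝ, 0 ≤ y → ‖min y x‖ ≤ |x| := fun y hy => by
    rw [Real.norm_eq_abs, abs_le]
    exact ⟨le_min ((neg_nonpos.2 (abs_nonneg x)).trans hy) (neg_abs_le x),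
      (min_le_right _ _).trans (le_abs_self x)⟩
  have hi₁ : Integrable (fun u => min u x) uniform01 :=
    Integrable.of_bound (by fun_prop) |x| (ae_uniform01_mem_Ioo.mono fun u hu => hbound u hu.1.le)
  have hi₂ : Integrable (fun ω => min (P ω) x) μ :=
    Integrable.of_bound (by fun_prop) |x| (Filter.Eventually.of_forall fun ω => hbound _ (hP0 ω))
  have hle := h (fun y => min y x) (fun y z hyz => min_le_min_right x hyz)
    ((concaveOn_id convex_univ).inf (concaveOn_const x convex_univ))
    hi₁.expectationExists hi₂.expectationExists
  rwa [extExpectation_eq_integral hi₁, extExpectation_eq_integral hi₂, EReal.coe_le_coe_iff] at hle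

/-- The distribution function of `T` evaluated at `T` is a p-variable, since `F (F⁻¹ u) ≥ u`. -/
lemma extExpectation_uniform01_le_comp_cdf {T : Ω → ℝ} (hT : Measurable T) {f : ℝ → ℝ}
    (hf : Monotone f) :
    extExpectation uniform01 f ≤
      extExpectation μ (fun ω => f ((μ.map T).real (Set.Iic (T ω)))) := by
  set m := μ.map T with hm
  have hmp : IsProbabilityMeasure m := Measure.isProbabilityMeasure_map hT.aemeasurable
  have hF : Monotone fun t : ℝ => m.real (Set.Iic t) := fun s t hst =>
    measureReal_mono (Set.Iic_subset_Iic.2 hst)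
  have hfF : Measurable fun t => f (m.real (Set.Iic t)) := (hf.comp hF).measurable
  calc extExpectation uniform01 f
      ≤ extExpectation uniform01 (fun u => f (m.real (Set.Iic (quantile m u)))) :=
        extExpectation_mono (ae_uniform01_mem_Ioo.mono fun u hu =>
          hf (le_measureReal_Iic_quantile (by rwa [probReal_univ])))
    _ = extExpectation m (fun t => f (m.real (Set.Iic t))) := by
        rw [← extExpectation_map (measurable_quantile m) hfF, map_quantile_uniform01]
    _ = extExpectation μ (fun ω => f (m.real (Set.Iic (T ω)))) := by
        rw [hm, extExpectation_map hT (by rwa [← hm])]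

end Expectation

/-! ### Conditional probabilities under independence -/

section Conditional

variable {Ω E : Type*} [MeasurableSpace Ω] [mE : MeasurableSpace E] {μ : Measure Ω}
  [IsProbabilityMeasure μ] {X : Ω → E}

/-- If `Y` is independent of `X`, conditioning `1_S (X, Y)` on `X` integrates out `Y`. -/
lemma condExp_indicator_prodMk_of_indepFun {S : Type*} [MeasurableSpace S] [StandardBorelSpace S]
    [Nonempty S] (hX : Measurable X) {Y : Ω → S} (hY : Measurable Y) (hYX : IndepFun Y X μ)
    {A : Set (E × S)} (hA : MeasurableSet A) :
    μ[{ω | (X ω, Y ω) ∈ A}.indicator (fun _ => (1 : ℝ)) | mE.comap X] =ᵐ[μ]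
      fun ω => (μ.map Y).real {y | (X ω, y) ∈ A} := by
  have : IsProbabilityMeasure (μ.map Y) := Measure.isProbabilityMeasure_map hY.aemeasurable
  have : IsProbabilityMeasure (μ.map X) := Measure.isProbabilityMeasure_map hX.aemeasurable
  have hcd : condDistrib Y X μ =ᵐ[μ.map X] Kernel.const E (μ.map Y) := by
    refine condDistrib_ae_eq_of_measure_eq_compProd X hY.aemeasurable ?_
    rw [Measure.compProd_const]
    exact (indepFun_iff_map_prod_eq_prod_map_map hX.aemeasurable hY.aemeasurable).1 hYX.symm
  have hint : Integrable (fun ω => A.indicator (fun _ => (1 : ℝ)) (X ω, Y ω)) μ :=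
    (integrable_const (1 : ℝ)).indicator (hX.prodMk hY hA)
  have hmain := condExp_prod_ae_eq_integral_condDistrib hX hY.aemeasurable
    (f := A.indicator fun _ => (1 : ℝ)) (stronglyMeasurable_const.indicator hA) hint
  filter_upwards [hmain, ae_of_ae_map hX.aemeasurable hcd] with ω h1 h2
  refine h1.trans ?_
  rw [h2, Kernel.const_apply]
  exact integral_indicator_one (measurable_prodMk_left hA)

/-- `ℙ(T' ≤ T ∣ X) = F(T)` when `T` is a function of `X` and `T'`, with distribution function `F`,
is independent of `X`. -/
lemma condProbLE_eq_of_indepFun (hX : Measurable X) {T T' : Ω → ℝ}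
    (hT : Measurable[mE.comap X] T) (hT' : Measurable T') (hind : IndepFun T' X μ) :
    condProbLE μ T' T X =ᵐ[μ] fun ω => (μ.map T').real (Set.Iic (T ω)) := by
  obtain ⟨g, hg, rfl⟩ := hT.exists_eq_measurable_comp
  exact condExp_indicator_prodMk_of_indepFun hX hT' hind
    (A := {z | z.2 ≤ g z.1}) (measurableSet_le measurable_snd (hg.comp measurable_fst))

end Conditional

/-! ### The two characterizations -/

section Characterization

variable {Ω E : Type*} [MeasurableSpace Ω] [mE : MeasurableSpace E] {μ : Measure Ω}
  {X : Ω → E}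

/-- The randomness independent of `X` can be turned into a variable of any given law. -/
lemma exists_indepFun_map_eq
    (hrich : ∃ U : Ω → ℝ, Measurable U ∧ μ.map U = uniform01 ∧ IndepFun U X μ)
    {S : Type*} [MeasurableSpace S] [StandardBorelSpace S] [Nonempty S] (m : Measure S)
    [IsProbabilityMeasure m] :
    ∃ W : Ω → S, Measurable W ∧ μ.map W = m ∧ IndepFun W X μ := by
  obtain ⟨U, hU, hUlaw, hUX⟩ := hrich
  obtain ⟨f, hf, hfm⟩ := m.exists_measurable_map_eq
  have hpr : Measurable (Set.projIcc (0 : ℝ) 1 zero_le_one) := continuous_projIcc.measurable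
  refine ⟨fun ω => f (Set.projIcc 0 1 zero_le_one (U ω)), hf.comp (hpr.comp hU), ?_,
    hUX.comp (hf.comp hpr) measurable_id⟩
  rw [← hfm, ← map_projIcc_uniform01, ← hUlaw, Measure.map_map hpr hU,
    Measure.map_map hf (hpr.comp hU)]
  rfl

variable [IsProbabilityMeasure μ]

/-- A p-variable `P` itself serves as the statistic `T`, since its distribution function lies below
the identity. -/
lemma IsPVariable.exists_statistic (hX : Measurable X)
    (hrich : ∃ U : Ω → ℝ, Measurable U ∧ μ.map U = uniform01 ∧ IndepFun U X μ)
    {P : Ω → ℝ} (hP : Measurable[mE.comap X] P) (hP0 : ∀ ω, 0 ≤ P ω) (h : IsPVariable μ P) :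
    ∃ T T' : Ω → ℝ, Measurable[mE.comap X] T ∧ Measurable T' ∧
      IdentDistrib T' T μ μ ∧ IndepFun T' X μ ∧ ∀ᵐ ω ∂μ, condProbLE μ T' T X ω ≤ P ω := by
  have hPm : Measurable P := hP.mono hX.comap_le le_rfl
  have : IsProbabilityMeasure (μ.map P) := Measure.isProbabilityMeasure_map hPm.aemeasurable
  obtain ⟨T', hT', hlaw, hind⟩ := exists_indepFun_map_eq hrich (μ.map P)
  refine ⟨P, T', hP, hT', ⟨hT'.aemeasurable, hPm.aemeasurable, hlaw⟩, hind, ?_⟩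
  filter_upwards [condProbLE_eq_of_indepFun hX hP hT' hind] with ω hω
  rw [hω, hlaw]
  rcases le_total (P ω) 1 with h1 | h1
  · rw [map_measureReal_apply hPm measurableSet_Iic]
    exact h.measureReal_le hPm (hP0 ω) h1
  · exact measureReal_le_one.trans h1

lemma isPVariable_of_condProbLE_le (hX : Measurable X) {P T T' : Ω → ℝ}
    (hT : Measurable[mE.comap X] T) (hT' : Measurable T') (hid : IdentDistrib T' T μ μ)
    (hind : IndepFun T' X μ) (hle : ∀ᵐ ω ∂μ, condProbLE μ T' T X ω ≤ P ω) :
    IsPVariable μ P := by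
  intro f hf _ _
  refine (extExpectation_uniform01_le_comp_cdf (hT.mono hX.comap_le le_rfl) hf).trans
    (extExpectation_mono ?_)
  filter_upwards [hle, condProbLE_eq_of_indepFun hX hT hT' hind] with ω h1 h2
  rw [h2, hid.map_eq] at h1
  exact hf h1

/-- Given independent uniform variables `W₁`, `W₂`, take for `T` the uniform variable sampled from
`min P 1` and `W₂` by Strassen's theorem, and `T' = W₁`; then `ℙ(T' ≤ T ∣ X) = 𝔼[T ∣ X] ≤ P`. -/
lemma IsPStarVariable.exists_statistic (hX : Measurable X)
    (hrich : ∃ U : Ω → ℝ, Measurable U ∧ μ.map U = uniform01 ∧ IndepFun U X μ)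
    {P : Ω → ℝ} (hP : Measurable[mE.comap X] P) (hP0 : ∀ ω, 0 ≤ P ω) (h : IsPStarVariable μ P) :
    ∃ T T' : Ω → ℝ, Measurable T ∧ Measurable T' ∧
      IdentDistrib T' T μ μ ∧ IndepFun T' (fun ω => (T ω, X ω)) μ ∧
      ∀ᵐ ω ∂μ, condProbLE μ T' T X ω ≤ P ω := by
  obtain ⟨g, hg, rfl⟩ := hP.exists_eq_measurable_comp
  set g₁ : E → ℝ := fun x => min (g x) 1 with hg₁def
  have hg₁ : Measurable g₁ := hg.min measurable_const
  have hgX : Measurable fun ω => g₁ (X ω) := hg₁.comp hX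
  set ν := μ.map fun ω => g₁ (X ω) with hνdef
  have hνp : IsProbabilityMeasure ν := Measure.isProbabilityMeasure_map hgX.aemeasurable
  have hν : ∀ᵐ p ∂ν, p ∈ Set.Icc (0 : ℝ) 1 :=
    (ae_map_iff hgX.aemeasurable measurableSet_Icc).2 (Filter.Eventually.of_forall fun ω =>
      ⟨le_min (hP0 ω) zero_le_one, min_le_right _ _⟩)
  -- `min · 1` is invisible to the uniform law, so truncating `P` at `1` preserves dominance
  have hmin : ∀ x, ∫ u, min u x ∂uniform01 ≤ ∫ p, min p x ∂ν := by
    intro x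
    rw [hνdef, integral_map hgX.aemeasurable (by fun_prop)]
    calc ∫ u, min u x ∂uniform01 = ∫ u, min u (min 1 x) ∂uniform01 := by
          refine integral_congr_ae (ae_uniform01_mem_Ioo.mono fun u hu => ?_)
          simp only
          rw [← min_assoc, min_eq_left hu.2.le]
      _ ≤ ∫ ω, min (g (X ω)) (min 1 x) ∂μ :=
          h.integral_min_le (hg.comp hX) hP0 _
      _ = ∫ ω, min (g₁ (X ω)) x ∂μ := by simp only [hg₁def, min_assoc]
  obtain ⟨k, hk, hklaw, hkmean⟩ := exists_uniform_randomization ν hν hmin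
  obtain ⟨W, hW, hWlaw, hWX⟩ := exists_indepFun_map_eq hrich
    ((volume : Measure unitInterval).prod (volume : Measure unitInterval))
  have hW₁ : Measurable fun ω => (W ω).1 := measurable_fst.comp hW
  have hW₂ : Measurable fun ω => (W ω).2 := measurable_snd.comp hW
  have hW₁law : μ.map (fun ω => (W ω).1) = volume := by
    change μ.map (Prod.fst ∘ W) = volume
    rw [← Measure.map_map measurable_fst hW, hWlaw, Measure.map_fst_prod, measure_univ, one_smul]
  have hW₂law : μ.map (fun ω => (W ω).2) = volume := by
    change μ.map (Prod.snd ∘ W) = volume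
    rw [← Measure.map_map measurable_snd hW, hWlaw, Measure.map_snd_prod, measure_univ, one_smul]
  have hW₂X : IndepFun (fun ω => (W ω).2) X μ := hWX.comp measurable_snd measurable_id
  have hXp : IsProbabilityMeasure (μ.map X) := Measure.isProbabilityMeasure_map hX.aemeasurable
  have hind : IndepFun (fun ω => (W ω).1) (fun ω => ((W ω).2, X ω)) μ := by
    rw [indepFun_iff_map_prod_eq_prod_map_map hW₁.aemeasurable (hW₂.prodMk hX).aemeasurable,
      (indepFun_iff_map_prod_eq_prod_map_map hW₂.aemeasurable hX.aemeasurable).1 hW₂X, hW₁law,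
      hW₂law, ← (measurePreserving_prodAssoc volume volume (μ.map X)).map_eq, ← hWlaw,
      ← (indepFun_iff_map_prod_eq_prod_map_map hW.aemeasurable hX.aemeasurable).1 hWX,
      Measure.map_map MeasurableEquiv.prodAssoc.measurable (hW.prodMk hX)]
    rfl
  set T : Ω → ℝ := fun ω => k (g₁ (X ω)) (W ω).2 with hTdef
  set T' : Ω → ℝ := fun ω => ((W ω).1 : ℝ) with hT'def
  have hT : Measurable T := hk.comp (hgX.prodMk hW₂)
  have hT' : Measurable T' := measurable_subtype_coe.comp hW₁
  have hTlaw : μ.map T = uniform01 := by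
    have hpair := (indepFun_iff_map_prod_eq_prod_map_map hgX.aemeasurable hW₂.aemeasurable).1
      (hW₂X.symm.comp hg₁ measurable_id)
    rw [← hklaw, hνdef, ← hW₂law, ← hpair, Measure.map_map hk (hgX.prodMk hW₂)]
    rfl
  have hT'law : μ.map T' = uniform01 := by
    rw [← map_coe_unitInterval, ← hW₁law, Measure.map_map measurable_subtype_coe hW₁]
    rfl
  refine ⟨T, T', hT, hT', ⟨hT'.aemeasurable, hT.aemeasurable, hT'law.trans hTlaw.symm⟩, ?_, ?_⟩
  · have hφ : Measurable fun z : unitInterval × E => (k (g₁ z.2) z.1, z.2) :=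
      (hk.comp ((hg₁.comp measurable_snd).prodMk measurable_fst)).prodMk measurable_snd
    exact hind.comp measurable_subtype_coe hφ
  · have hA : MeasurableSet {z : E × (unitInterval × unitInterval) |
        (z.2.1 : ℝ) ≤ k (g₁ z.1) z.2.2} :=
      measurableSet_le (by fun_prop)
        (hk.comp ((hg₁.comp measurable_fst).prodMk (measurable_snd.comp measurable_snd)))
    have hcond := condExp_indicator_prodMk_of_indepFun hX hW hWX hA
    filter_upwards [hcond, ae_of_ae_map hgX.aemeasurable hkmean] with ω h1 h2
    refine (h1.trans_le ?_).trans (min_le_left (g (X ω)) 1)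
    have hkp : Measurable (k (g₁ (X ω))) := hk.of_uncurry_left
    have hB : MeasurableSet {w : unitInterval × unitInterval | (w.1 : ℝ) ≤ k (g₁ (X ω)) w.2} :=
      measurableSet_le (by fun_prop) (hkp.comp measurable_snd)
    refine ENNReal.toReal_le_of_le_ofReal (le_min (hP0 ω) zero_le_one) ?_
    rw [hWlaw]
    calc (volume.prod volume) {w : unitInterval × unitInterval | (w.1 : ℝ) ≤ k (g₁ (X ω)) w.2}
        = ∫⁻ b : unitInterval, volume {a : unitInterval | (a : ℝ) ≤ k (g₁ (X ω)) b} :=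
          Measure.prod_apply_symm hB
      _ ≤ ∫⁻ b : unitInterval, ENNReal.ofReal (k (g₁ (X ω)) b) := by
          refine lintegral_mono fun b => ?_
          set c := k (g₁ (X ω)) b
          have hc : volume {a : unitInterval | (a : ℝ) ≤ c} = uniform01 (Set.Iic c) := by
            rw [← map_coe_unitInterval, Measure.map_apply measurable_subtype_coe measurableSet_Iic]
            rfl
          rw [hc, uniform01, Measure.restrict_apply measurableSet_Iic]
          calc volume (Set.Iic c ∩ Set.Icc 0 1) ≤ volume (Set.Icc 0 c) :=
                measure_mono fun a ha => ⟨ha.2.1, ha.1⟩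
            _ = ENNReal.ofReal c := by rw [Real.volume_Icc, sub_zero]
      _ ≤ ENNReal.ofReal (g₁ (X ω)) := h2

/-- `ℙ(T' ≤ T ∣ X)` is the conditional expectation given `X` of the p-variable `F(T)`; conditional
Jensen shows that this averaging increases expectations of concave functions. -/
lemma isPStarVariable_of_condProbLE_le (hX : Measurable X) {P T T' : Ω → ℝ}
    (hT : Measurable T) (hT' : Measurable T') (hid : IdentDistrib T' T μ μ)
    (hind : IndepFun T' (fun ω => (T ω, X ω)) μ)
    (hle : ∀ᵐ ω ∂μ, condProbLE μ T' T X ω ≤ P ω) :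
    IsPStarVariable μ P := by
  intro f hf hconc _ _
  have hTX : Measurable fun ω => (T ω, X ω) := hT.prodMk hX
  set G : Ω → ℝ := fun ω => (μ.map T).real (Set.Iic (T ω)) with hGdef
  have hmp : IsProbabilityMeasure (μ.map T) := Measure.isProbabilityMeasure_map hT.aemeasurable
  have hG01 : ∀ ω, G ω ∈ Set.Icc (0 : ℝ) 1 := fun ω => ⟨measureReal_nonneg, measureReal_le_one⟩
  have hGm : Measurable G :=
    (show Monotone fun t : ℝ => (μ.map T).real (Set.Iic t) from fun s t hst =>
      measureReal_mono (Set.Iic_subset_Iic.2 hst)).measurable.comp hT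
  have hGint : Integrable G μ := Integrable.of_bound hGm.aestronglyMeasurable 1
    (Filter.Eventually.of_forall fun ω => by
      rw [Real.norm_eq_abs, abs_of_nonneg (hG01 ω).1]; exact (hG01 ω).2)
  have hsub : mE.comap X ≤ MeasurableSpace.comap (fun ω => (T ω, X ω)) inferInstance :=
    (measurable_snd.comp (comap_measurable fun ω => (T ω, X ω))).comap_le
  have hcond : condProbLE μ T' T X =ᵐ[μ] μ[G | mE.comap X] := by
    have hinner : condProbLE μ T' T (fun ω => (T ω, X ω)) =ᵐ[μ] G := by
      have := condProbLE_eq_of_indepFun hTX (T := T)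
        (measurable_fst.comp (comap_measurable fun ω => (T ω, X ω))) hT' hind
      rwa [hid.map_eq] at this
    exact (condExp_condExp_of_le hsub hTX.comap_le).symm.trans (condExp_congr_ae hinner)
  have hY01 : ∀ᵐ ω ∂μ, (μ[G | mE.comap X]) ω ∈ Set.Icc (0 : ℝ) 1 := by
    have h0 := condExp_nonneg (m := mE.comap X)
      (Filter.Eventually.of_forall fun ω => (hG01 ω).1 : 0 ≤ᵐ[μ] G)
    have h1 := condExp_mono (m := mE.comap X) hGint (integrable_const (1 : ℝ))
      (Filter.Eventually.of_forall fun ω => (hG01 ω).2)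
    rw [condExp_const hX.comap_le] at h1
    filter_upwards [h0, h1] with ω a b using ⟨a, b⟩
  have hfint : ∀ Y : Ω → ℝ, AEMeasurable Y μ → (∀ᵐ ω ∂μ, Y ω ∈ Set.Icc (0 : ℝ) 1) →
      Integrable (fun ω => f (Y ω)) μ := fun Y hY h01 =>
    Integrable.of_bound (hf.measurable.comp_aemeasurable hY).aestronglyMeasurable
      (max |f 0| |f 1|) (h01.mono fun ω hω => abs_le_max_abs_abs (hf hω.1) (hf hω.2))
  have hi₁ := hfint G hGm.aemeasurable (Filter.Eventually.of_forall hG01)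
  have hi₂ := hfint _ integrable_condExp.1.aemeasurable hY01
  have hcont : Continuous f :=
    continuousOn_univ.1 (hconc.continuousOn isOpen_univ)
  have hjensen := hconc.condExp_map_le_univ hX.comap_le hcont.upperSemicontinuous hGint hi₁
  calc extExpectation uniform01 f ≤ extExpectation μ (fun ω => f (G ω)) :=
        extExpectation_uniform01_le_comp_cdf hT hf
    _ ≤ extExpectation μ (fun ω => f ((μ[G | mE.comap X]) ω)) := by
        rw [extExpectation_eq_integral hi₁, extExpectation_eq_integral hi₂, EReal.coe_le_coe_iff,
          ← integral_condExp hX.comap_le (f := fun ω => f (G ω))]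
        exact integral_mono_ae integrable_condExp hi₂ hjensen
    _ ≤ extExpectation μ (fun ω => f (P ω)) := by
        refine extExpectation_mono ?_
        filter_upwards [hle, hcond] with ω h1 h2
        exact hf (h2 ▸ h1)

end Characterization

theorem mainTheorem2 {Ω E : Type*} [MeasurableSpace Ω] [mE : MeasurableSpace E]
    (μ : Measure Ω) [IsProbabilityMeasure μ]
    (X : Ω → E) (hX : Measurable X)
    (hrich : ∃ U : Ω → ℝ, Measurable U ∧ μ.map U = uniform01 ∧ IndepFun U X μ)
    (P : Ω → ℝ) (hP : Measurable[MeasurableSpace.comap X mE] P) (hP0 : ∀ ω, 0 ≤ P ω) :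
    (IsPVariable μ P ↔
      ∃ T T' : Ω → ℝ, Measurable[MeasurableSpace.comap X mE] T ∧ Measurable T' ∧
        IdentDistrib T' T μ μ ∧ IndepFun T' X μ ∧
        ∀ᵐ ω ∂μ, condProbLE μ T' T X ω ≤ P ω) ∧
    (IsPStarVariable μ P ↔
      ∃ T T' : Ω → ℝ, Measurable T ∧ Measurable T' ∧
        IdentDistrib T' T μ μ ∧ IndepFun T' (fun ω => (T ω, X ω)) μ ∧
        ∀ᵐ ω ∂μ, condProbLE μ T' T X ω ≤ P ω) := by
  refine ⟨⟨fun h => h.exists_statistic hX hrich hP hP0, ?_⟩,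
    ⟨fun h => h.exists_statistic hX hrich hP hP0, ?_⟩⟩
  · rintro ⟨T, T', hT, hT', hid, hind, hle⟩
    exact isPVariable_of_condProbLE_le hX hT hT' hid hind hle
  · rintro ⟨T, T', hT, hT', hid, hind, hle⟩
    exact isPStarVariable_of_condProbLE_le hX hT hT' hid hind hle
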